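/- Let $n\ge 1$ be an integer. For a finite field $\mathbb F_q$ with $q$ elements ($q$ any prime power), let $\mathbb H_n(\mathbb F_q)=\mathbb F_q^n\times\mathbb F_q^n\times\mathbb F_q$ be the Heisenberg group with the group law $$(\mathbf x,\mathbf y,t)\cdot(\mathbf x',\mathbf y',t')=\bigl(\mathbf x+\mathbf x',\ \mathbf y+\mathbf y',\ t+t'+(\mathbf x\cdot\mathbf y'-\mathbf y\cdot\mathbf x')\bigr).$$ For $\mathbf p\in\mathbb H_n(\mathbb F_q)$ and a direction $[\mathbf v]\in\mathbb P^{2n-1}(\mathbb F_q)$ represented by $\mathbf v=(\mathbf a,\mathbf b)\in(\mathbb F_q^n\times\mathbb F_q^n)\setminus\{\mathbf 0\}$, let $$L_{\mathbf p,[\mathbf v]}=\{\mathbf p\cdot(s\mathbf a,s\mathbf b,0): s\in\mathbb F_q\}$$ be the horizontal line through $\mathbf p$ in direction $[\mathbf v]$, and for $F:\mathbb H_n(\mathbb F_q)\to\mathbb C$ define the horizontal Kakeya maximal operator $$\mathcal M_{\mathbb H_n}F([\mathbf v])=\max_{\mathbf p\in\mathbb H_n(\mathbb F_q)}\ \sum_{\mathbf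 z\in L_{\mathbf p,[\mathbf v]}}|F(\mathbf z)|.$$ All $\ell^p$ norms, $1\le p\le\infty$, are taken with respect to counting measure. For $1\le u,v\le\infty$, let $A_n(u,v)$ be the smallest non-negative real number $A$ for which there is a constant $C>0$, independent of $q$ and $F$, such that $$\|\mathcal M_{\mathbb H_n}F\|_{\ell^v(\mathbb P^{2n-1}(\mathbb F_q))}\le C\,q^{A}\,\|F\|_{\ell^u(\mathbb H_n(\mathbb F_q))}$$ for all finite fields $\mathbb F_q$ and all $F:\mathbb H_n(\mathbb F_q)\to\mathbb C$. Then for all $n\ge1$ and all $1\le u,v\le\infty$ the number $A_n(u,v)$ exists (the smallest value is attained) and, with the convention $1/\infty=0$, $$A_n(u,v)=\max\Bigl(\frac{2n-1}{v},\ 1-\frac1u,\ 1+\frac{2n-1}{v}-\frac{2n}{u}\Bigr).$$ -/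

import Mathlib

open scoped ENNReal LinearAlgebra.Projectivization

/-- The Heisenberg group `ℍ_n(F)`: triples `(x, y, t)` in `F^n × F^n × F`. -/
@[ext]
structure Heisenberg (n : ℕ) (F : Type) where
  x : Fin n → F
  y : Fin n → F
  t : F

namespace Heisenberg

variable {n : ℕ} {F : Type}

/-- The identification of `ℍ_n(F)` with `F^n × F^n × F` as sets. -/
def equivProd (n : ℕ) (F : Type) :
    Heisenberg n F ≃ (Fin n → F) × (Fin n → F) × F where
  toFun p := (p.x, p.y, p.t)
  invFun p := ⟨p.1, p.2.1, p.2.2⟩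

instance [Fintype F] : Fintype (Heisenberg n F) :=
  Fintype.ofEquiv _ (equivProd n F).symm

variable [Field F]

/-- The group law `(x,y,t)·(x',y',t') = (x + x', y + y', t + t' + (x·y' - y·x'))`. -/
instance : Mul (Heisenberg n F) :=
  ⟨fun p p' => ⟨p.x + p'.x, p.y + p'.y, p.t + p'.t + (p.x ⬝ᵥ p'.y - p.y ⬝ᵥ p'.x)⟩⟩

instance : One (Heisenberg n F) := ⟨⟨0, 0, 0⟩⟩

instance : Inv (Heisenberg n F) := ⟨fun p => ⟨-p.x, -p.y, -p.t⟩⟩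

@[simp] theorem mul_x (p p' : Heisenberg n F) : (p * p').x = p.x + p'.x := rfl
@[simp] theorem mul_y (p p' : Heisenberg n F) : (p * p').y = p.y + p'.y := rfl
@[simp] theorem mul_t (p p' : Heisenberg n F) :
    (p * p').t = p.t + p'.t + (p.x ⬝ᵥ p'.y - p.y ⬝ᵥ p'.x) := rfl
@[simp] theorem one_x : (1 : Heisenberg n F).x = 0 := rfl
@[simp] theorem one_y : (1 : Heisenberg n F).y = 0 := rfl
@[simp] theorem one_t : (1 : Heisenberg n F).t = 0 := rfl
@[simp] theorem inv_x (p : Heisenberg n F) : p⁻¹.x = -p.x := rfl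
@[simp] theorem inv_y (p : Heisenberg n F) : p⁻¹.y = -p.y := rfl
@[simp] theorem inv_t (p : Heisenberg n F) : p⁻¹.t = -p.t := rfl

instance : Group (Heisenberg n F) :=
  Group.ofLeftAxioms
    (fun p q r => by
      ext i
      · simp [add_assoc]
      · simp [add_assoc]
      · simp only [mul_t, mul_x, mul_y, add_dotProduct, dotProduct_add]
        ring)
    (fun p => by ext i <;> simp)
    (fun p => by
      ext i
      · simp
      · simp
      · simp [dotProduct_comm])

/-- The horizontal element `(a, b, 0)` attached to `v = (a, b)`. -/
def horiz (v : (Fin n → F) × (Fin n → F)) : Heisenberg n F := ⟨v.1, v.2, 0⟩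

/-- The horizontal line `L_{p,[v]} = { p · (s a, s b, 0) : s ∈ F }`. The elements `s v`, `s ∈ F`,
are those of the one-dimensional subspace `[v]`, see `horizontalLine_mk`. -/
def horizontalLine (p : Heisenberg n F) (d : ℙ F ((Fin n → F) × (Fin n → F))) :
    Set (Heisenberg n F) :=
  {z | ∃ w ∈ d.submodule, z = p * horiz w}

theorem horizontalLine_mk (p : Heisenberg n F) (v : (Fin n → F) × (Fin n → F)) (hv : v ≠ 0) :
    horizontalLine p (Projectivization.mk F v hv)
      = {z | ∃ s : F, z = p * horiz (s • v)} := by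
  ext z
  simp [horizontalLine, Projectivization.submodule_mk, Submodule.mem_span_singleton]

variable [Fintype F]

noncomputable instance : Fintype (ℙ F ((Fin n → F) × (Fin n → F))) := Fintype.ofFinite _

open Classical in
/-- The horizontal Kakeya maximal operator
`(M f)([v]) = max_p ∑_{z ∈ L_{p,[v]}} |f z|` (sums, not averages). The supremum is over a finite
nonempty set, so it is a maximum. -/
noncomputable def kakeyaMaximal (f : Heisenberg n F → ℂ)
    (d : ℙ F ((Fin n → F) × (Fin n → F))) : ℝ :=
  ⨆ p : Heisenberg n F, ∑ z with z ∈ horizontalLine p d, ‖f z‖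

end Heisenberg

/-- The `ℓ^p` norm with respect to counting measure of a function on a finite set `X`
(the maximum of `‖g x‖` if `p = ∞`). -/
noncomputable def ellNorm {X E : Type} [Fintype X] [NormedAddCommGroup E] (p : ℝ≥0∞)
    (g : X → E) : ℝ :=
  ‖(WithLp.toLp p g : PiLp p (fun _ : X => E))‖

/-- The non-negative reals `A` such that, for some `C > 0` independent of `F_q` and `f`,
`‖M f‖_{ℓ^v(ℙ^{2n-1}(F_q))} ≤ C q^A ‖f‖_{ℓ^u(ℍ_n(F_q))}`
for all finite fields `F_q` (each is isomorphic to one in `Type`) and all `f : ℍ_n(F_q) → ℂ`.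
The exponent `A_n(u,v)` is the least element of this set. -/
def admissibleExponents (n : ℕ) (u v : ℝ≥0∞) : Set ℝ :=
  {A | 0 ≤ A ∧ ∃ C : ℝ, 0 < C ∧
    ∀ (F : Type) [Field F] [Fintype F] (f : Heisenberg n F → ℂ),
      ellNorm v (Heisenberg.kakeyaMaximal f)
        ≤ C * (Fintype.card F : ℝ) ^ A * ellNorm u f}

/-!
Write `N = 2n`, `k = N - 1`, and let `M` be the maximal operator. All upper bounds come from the
strong estimate `ℓ^N → ℓ^N`: for every choice of one horizontal line in each direction,
`∑_d (∑_{L_d} G)^N ≤ C q^k ∑ G^N` for `G ≥ 0`. Horizontal lines project to lines of `F^N`, so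
replacing `G` by its maximum over the centre reduces this to the Kakeya maximal estimate in `F^N`
(`sum_projectivization_line_sum_pow_le`).

That estimate is proved by the polynomial method with multiplicities. Let `f ≥ 0` be integer valued,
and impose on a polynomial `P` in `N` variables vanishing to order `f x` at every point `x`, which
is at most `∑ f^N` linear conditions. Suppose that `P` has degree `D`, and that a line of direction
`d` has weight `h = ∑_{x ∈ L} f x` with `h > D + q m`. Bézout along the line, with the direction
thickened to order `m` (`aeval_line_eq_zero`), shows that the top homogeneous component of `P`
vanishes to order `m` at `d`. For every degree `D` between fixed multiples of `h_d`, where `h_d` is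
the weight of the chosen line of direction `d`, one can take `m` comparable to `h_d / q`, and there
are about `(h_d / q)^k` forms of degree `D` which are independent modulo vanishing of order `m` at
`d` and vanish to high order at the other directions (`directionForm`). Hence about
`∑_d h_d (h_d / q)^k` polynomials are independent modulo the vanishing conditions
(`FormIndex.linearIndependent_vanishingConditions`), which bounds that number by `∑ f^N`. Counting
forms in all degrees, rather than in a single one, is what gives the strong type inequality
directly. A scaling argument passes from integral to real `f`.

For general exponents, Hölder's inequality on each line deduces from the strong estimate the bound
`‖M f‖_v ≤ C q^(1 - 1/u) ‖f‖_u` on the critical line `1/v = min (1/u, (1 - 1/u)/k)`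
(`exists_critical_exponent_ellNorm_le`). The remaining `v` follow from monotonicity of the norms,
as there are at most `2 q^k` directions.

Sharpness (`Heisenberg.necessary_bounds`) comes from the indicators of a horizontal line, of a
point, and of the set `t = 0`, which has `q^N` elements and contains a horizontal line in every
direction, over the prime fields.
-/

/-! ### Polynomials along a line -/

section Lines

open Polynomial

variable {R A ι : Type*} [CommRing R] [CommRing A] [Algebra R A]

theorem natDegree_prod_le_sum_and_coeff (s : Finset ι) (g : ι → A[X]) (e : ι → ℕ)
    (h : ∀ i ∈ s, (g i).natDegree ≤ e i) :
    (∏ i ∈ s, g i).natDegree ≤ ∑ i ∈ s, e i ∧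
      (∏ i ∈ s, g i).coeff (∑ i ∈ s, e i) = ∏ i ∈ s, (g i).coeff (e i) := by
  classical
  induction s using Finset.induction_on with
  | empty => simp
  | insert a s ha ih =>
    obtain ⟨h1, h2⟩ := ih fun i hi => h i (Finset.mem_insert_of_mem hi)
    have h3 := h a (Finset.mem_insert_self a s)
    simp only [Finset.prod_insert ha, Finset.sum_insert ha]
    exact ⟨natDegree_mul_le_of_le h3 h1, by rw [coeff_mul_add_eq_of_natDegree_le h3 h1, h2]⟩

/-- Restricting a form of degree `D` to the line `u + X v` gives a polynomial of degree at most `D`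
in the parameter, and its coefficient of degree `D` is the value of the form at the direction `v`
of the line. -/
theorem natDegree_aeval_line_le_and_coeff_of_isHomogeneous {Q : MvPolynomial ι R} {D : ℕ}
    (hQ : Q.IsHomogeneous D) (u v : ι → A) :
    (MvPolynomial.aeval (fun i => C (u i) + X * C (v i)) Q).natDegree ≤ D ∧
      (MvPolynomial.aeval (fun i => C (u i) + X * C (v i)) Q).coeff D = MvPolynomial.aeval v Q := by
  have hlin : ∀ i, (C (u i) + X * C (v i)).natDegree ≤ 1 := fun i => by
    compute_degree
  have hmon : ∀ d ∈ Q.support,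
      (∏ i ∈ d.support, (C (u i) + X * C (v i)) ^ d i).natDegree ≤ D ∧
      (∏ i ∈ d.support, (C (u i) + X * C (v i)) ^ d i).coeff D = ∏ i ∈ d.support, v i ^ d i := by
    intro d hd
    have hD : ∑ i ∈ d.support, d i = D := by
      have := hQ (MvPolynomial.mem_support_iff.1 hd)
      rwa [show Finsupp.weight 1 d = Finsupp.degree d by
        rw [Finsupp.degree_eq_weight_one]; rfl] at this
    have := natDegree_prod_le_sum_and_coeff d.support
      (fun i => (C (u i) + X * C (v i)) ^ d i) d fun i _ => by
        simpa using natDegree_pow_le_of_le (d i) (hlin i)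
    rw [hD] at this
    refine ⟨this.1, this.2.trans (Finset.prod_congr rfl fun i _ => ?_)⟩
    have := coeff_pow_of_natDegree_le (m := d i) (hlin i)
    rw [mul_one] at this
    simpa using this
  simp only [MvPolynomial.aeval_def, MvPolynomial.eval₂_eq, Polynomial.algebraMap_apply]
  refine ⟨natDegree_sum_le_of_forall_le _ _ fun d hd =>
    (natDegree_C_mul_le _ _).trans (hmon d hd).1, ?_⟩
  rw [finsetSum_coeff]
  exact Finset.sum_congr rfl fun d hd => by rw [coeff_C_mul, (hmon d hd).2]

/-- A polynomial with vanishing order at least `m` at `x` takes values in `J ^ m` at points which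
agree with `x` modulo `J`. -/
theorem aeval_mem_pow_of_translate_mem {P : MvPolynomial ι R} {x : ι → R} {m : ℕ}
    (hP : MvPolynomial.aeval (fun i => MvPolynomial.X i + MvPolynomial.C (x i)) P ∈
      MvPolynomial.idealOfVars ι R ^ m)
    {J : Ideal A} {z : ι → A} (hz : ∀ i, z i - algebraMap R A (x i) ∈ J) :
    MvPolynomial.aeval z P ∈ J ^ m := by
  have hcomp : MvPolynomial.aeval z P =
      MvPolynomial.aeval (fun i => z i - algebraMap R A (x i))
        (MvPolynomial.aeval (fun i => MvPolynomial.X i + MvPolynomial.C (x i)) P) := by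
    rw [← AlgHom.comp_apply]
    congr 1
    ext i
    simp [MvPolynomial.algHom_C]
  rw [hcomp]
  have hle : (MvPolynomial.idealOfVars ι R).map
      (MvPolynomial.aeval fun i => z i - algebraMap R A (x i)) ≤ J := by
    rw [MvPolynomial.idealOfVars, Ideal.map_span, Ideal.span_le]
    rintro _ ⟨_, ⟨i, rfl⟩, rfl⟩
    simpa using hz i
  have := Ideal.mem_map_of_mem (MvPolynomial.aeval fun i => z i - algebraMap R A (x i)) hP
  rw [Ideal.map_pow] at this
  exact Ideal.pow_right_mono hle m this

variable {F : Type*} [Field F] [Fintype F] [Algebra F A]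

/-- Bézout on a thickened line. Let `P` vanish to order `f (p + s d)` at the points `p + s d` of a
line, and let `y` be a tuple of elements of an ideal `I` with `I ^ m = 0`. If the total vanishing
order on the line exceeds the degree of `P` by enough, then `P` vanishes identically on the line
through `p` with the perturbed direction `d + y`. -/
theorem aeval_line_eq_zero {P : MvPolynomial ι F} {f : (ι → F) → ℕ} {p d : ι → F}
    {I : Ideal A} {m D : ℕ} (hI : I ^ m = ⊥) {y : ι → A} (hy : ∀ i, y i ∈ I)
    (hP : ∀ s : F, MvPolynomial.aeval (fun i => MvPolynomial.X i + MvPolynomial.C ((p + s • d) i)) P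
      ∈ MvPolynomial.idealOfVars ι F ^ f (p + s • d))
    (hdeg : (MvPolynomial.aeval (fun i => C (algebraMap F A (p i)) +
      X * C (algebraMap F A (d i) + y i)) P).natDegree ≤ D)
    (hD : D + Fintype.card F * m < ∑ s : F, f (p + s • d)) :
    MvPolynomial.aeval (fun i => C (algebraMap F A (p i)) +
      X * C (algebraMap F A (d i) + y i)) P = 0 := by
  classical
  set G := MvPolynomial.aeval (fun i => C (algebraMap F A (p i)) +
      X * C (algebraMap F A (d i) + y i)) P with hG
  rcases subsingleton_or_nontrivial A with hA | hA
  · exact Subsingleton.elim _ _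
  have hIm : (I.map (C : A →+* A[X])) ^ m = ⊥ := by
    rw [← Ideal.map_pow, hI, Ideal.map_bot]
  have hdvd : ∀ s : F,
      (X - C (algebraMap F A s)) ^ (f (p + s • d) - m) ∣ G := by
    intro s
    rcases le_or_gt m (f (p + s • d)) with hm | hm
    -- At the parameter `s`, the point of the perturbed line is congruent to `p + s d` modulo
    -- `(X - s, I)`, and `I ^ m` vanishes.
    · have hmem : G ∈ (Ideal.span {X - C (algebraMap F A s)} ⊔
          I.map (C : A →+* A[X])) ^ f (p + s • d) := by
        refine aeval_mem_pow_of_translate_mem (hP s) fun i => ?_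
        have : C (algebraMap F A (p i)) + X * C (algebraMap F A (d i) + y i) -
            algebraMap F A[X] ((p + s • d) i) =
            C (algebraMap F A (d i)) * (X - C (algebraMap F A s)) +
              X * C (y i) := by
          simp only [Polynomial.algebraMap_apply, Pi.add_apply, Pi.smul_apply, smul_eq_mul,
            map_add, map_mul]
          ring
        rw [this]
        exact Ideal.add_mem _
          (Ideal.mem_sup_left (Ideal.mul_mem_left _ _ (Ideal.mem_span_singleton_self _)))
          (Ideal.mem_sup_right (Ideal.mul_mem_left _ _ (Ideal.mem_map_of_mem _ (hy i))))
      rw [← Nat.sub_add_cancel hm] at hmem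
      have := Ideal.sup_pow_add_le_pow_sup_pow hmem
      rwa [hIm, sup_bot_eq, Ideal.span_singleton_pow, Ideal.mem_span_singleton] at this
    · simp [Nat.sub_eq_zero_of_le hm.le]
  have hprod : ∏ s : F, (X - C (algebraMap F A s)) ^ (f (p + s • d) - m) ∣ G := by
    refine Finset.prod_dvd_of_coprime (fun s _ t _ hst => ?_) fun s _ => hdvd s
    refine IsCoprime.pow (isCoprime_X_sub_C_of_isUnit_sub ?_)
    rw [← map_sub]
    exact (sub_ne_zero_of_ne hst).isUnit.map _
  by_contra hne
  have hmonic : ∀ s : F,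
      ((X - C (algebraMap F A s)) ^ (f (p + s • d) - m)).Monic := fun s =>
    (monic_X_sub_C _).pow _
  refine (monic_prod_of_monic Finset.univ _ fun s _ => hmonic s).not_dvd_of_natDegree_lt
    hne (hdeg.trans_lt ?_) hprod
  rw [natDegree_prod_of_monic _ _ fun s _ => hmonic s]
  simp only [(monic_X_sub_C _).natDegree_pow, natDegree_X_sub_C, mul_one]
  have : ∑ s : F, f (p + s • d) ≤ ∑ s : F, ((f (p + s • d) - m) + m) :=
    Finset.sum_le_sum fun s _ => by omega
  rw [Finset.sum_add_distrib] at this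
  simp only [Finset.sum_const, Finset.card_univ, smul_eq_mul] at this
  omega

end Lines

/-! ### Independent forms attached to directions -/

section Forms

open MvPolynomial

variable {F A κ : Type*} [Field F] [Fintype F] [CommRing A] [Algebra F A]

/-- The direction `(1, w)` in `F^{1+κ}`. -/
def slopeDirection (w : κ → F) : Option κ → F := fun o => o.elim 1 w

variable [Fintype κ]

open Classical in
/-- The form `X₀^e (∏_i ∏_{c ≠ w_i} (X_i - c X₀))^M ∏_i (X_i - w_i X₀)^{α_i}`. At directions
`(1, w')` with `w' ≠ w` it vanishes to order at least `M`; near `(1, w)` it is a unit times the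
monomial of exponent `α` in the local coordinates. -/
noncomputable def directionForm (w : κ → F) (M e : ℕ) (α : κ → ℕ) : MvPolynomial (Option κ) F :=
  X none ^ e * (∏ i, ∏ c ∈ Finset.univ.erase (w i), (X (some i) - C c * X none)) ^ M *
    ∏ i, (X (some i) - C (w i) * X none) ^ α i

theorem isHomogeneous_directionForm (w : κ → F) (M e : ℕ) (α : κ → ℕ) :
    (directionForm w M e α).IsHomogeneous
      (e + Fintype.card κ * (Fintype.card F - 1) * M + ∑ i, α i) := by
  classical
  have hlin : ∀ (i : κ) (c : F),
      (X (some i) - C c * X none : MvPolynomial (Option κ) F).IsHomogeneous 1 := fun i c => by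
    have h2 : (C c * X none : MvPolynomial (Option κ) F).IsHomogeneous (0 + 1) :=
      (isHomogeneous_C _ c).mul (isHomogeneous_X F none)
    exact (isHomogeneous_X F (some i)).sub (by simpa using h2)
  refine IsHomogeneous.mul (IsHomogeneous.mul ?_ ?_) ?_
  · simpa using (isHomogeneous_X F (none : Option κ)).pow e
  · refine IsHomogeneous.pow ?_ M
    have := IsHomogeneous.prod (Finset.univ : Finset κ)
      (fun i => ∏ c ∈ Finset.univ.erase (w i), (X (some i) - C c * X none : MvPolynomial _ F))
      (fun _ => Fintype.card F - 1) fun i _ => by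
        have := IsHomogeneous.prod (Finset.univ.erase (w i))
          (fun c => (X (some i) - C c * X none : MvPolynomial (Option κ) F)) (fun _ => 1)
          fun c _ => hlin i c
        simpa [Finset.card_erase_of_mem] using this
    simpa using this
  · refine IsHomogeneous.prod _ _ _ fun i _ => ?_
    simpa using (hlin i (w i)).pow (α i)

/-- The tuple `(0, z)`, a perturbation transversal to the directions `(1, w)`. -/
def transversal (z : κ → A) : Option κ → A := fun o => o.elim 0 z

theorem aeval_directionForm_of_ne {w w₀ : κ → F} (hw : w ≠ w₀) {M : ℕ} (e : ℕ) (α : κ → ℕ)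
    {z : κ → A} (hz : ∀ i, z i ^ M = 0) :
    aeval (fun o => algebraMap F A (slopeDirection w₀ o) + transversal z o)
      (directionForm w M e α) = 0 := by
  classical
  obtain ⟨i, hi⟩ := Function.ne_iff.1 hw
  have hdvd : z i ∣ ∏ i, ∏ c ∈ Finset.univ.erase (w i), (algebraMap F A (w₀ i) + z i -
      algebraMap F A c) := by
    refine Dvd.dvd.trans ?_ (Finset.dvd_prod_of_mem _ (Finset.mem_univ i))
    refine Dvd.dvd.trans ?_ (Finset.dvd_prod_of_mem _ (a := w₀ i) (by simpa using Ne.symm hi))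
    simp
  have h0 := pow_dvd_pow_of_dvd hdvd M
  rw [hz i, zero_dvd_iff] at h0
  simp [directionForm, slopeDirection, transversal, h0]

/-- The unit that relates a direction form, near its direction, to a monomial. -/
theorem exists_unit_aeval_directionForm (w : κ → F) (M : ℕ) {z : κ → A}
    (hz : ∀ i, IsNilpotent (z i)) :
    ∃ U : Aˣ, ∀ (e : ℕ) (α : κ → ℕ),
      aeval (fun o => algebraMap F A (slopeDirection w o) + transversal z o)
        (directionForm w M e α) = U * ∏ i, z i ^ α i := by
  classical
  have hU : IsUnit ((∏ i, ∏ c ∈ Finset.univ.erase (w i), (algebraMap F A (w i) + z i -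
      algebraMap F A c)) ^ M) := by
    refine IsUnit.pow M (IsUnit.prod_univ_iff.2 fun i => IsUnit.prod_iff.2 fun c hc => ?_)
    have h1 : IsUnit (algebraMap F A (w i - c)) :=
      (sub_ne_zero_of_ne (Finset.ne_of_mem_erase hc).symm).isUnit.map _
    have := (hz i).isUnit_add_right_of_commute h1 (Commute.all _ _)
    rwa [map_sub, ← add_sub_assoc, add_comm (z i)] at this
  refine ⟨hU.unit, fun e α => ?_⟩
  simp [directionForm, slopeDirection, transversal]

omit [Fintype F] in
/-- The monomials of degree less than `m` are linearly independent modulo `(X)^m`. -/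
theorem eq_zero_of_sum_monomial_mem_pow_idealOfVars [DecidableEq κ] {a m : ℕ} (c : (κ → Fin a) → F)
    (hm : ∀ α : κ → Fin a, ∑ i, (α i : ℕ) < m)
    (h : ∑ α, C (c α) * ∏ i, X i ^ (α i : ℕ) ∈ idealOfVars κ F ^ m) : c = 0 := by
  funext α
  rw [mem_pow_idealOfVars_iff'] at h
  have hmono : ∀ γ : κ → Fin a, C (c γ) * ∏ i, X i ^ (γ i : ℕ) =
      monomial (Finsupp.equivFunOnFinite.symm fun i => (γ i : ℕ)) (c γ) := fun γ => by
    rw [monomial_eq, Finsupp.prod_fintype _ _ (by simp)]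
    simp
  have hdeg := h (Finsupp.equivFunOnFinite.symm fun i => (α i : ℕ)) (by
    simpa [Finsupp.degree_eq_sum] using hm α)
  simp only [hmono, coeff_sum, coeff_monomial] at hdeg
  rw [Finset.sum_eq_single α] at hdeg
  · simpa using hdeg
  · intro γ _ hγ
    rw [if_neg]
    intro heq
    apply hγ
    have := Finsupp.equivFunOnFinite.symm.injective heq
    funext i
    exact Fin.ext (congrFun this i)
  · simp

end Forms

/-! ### Counting vanishing conditions -/

section Counting

open MvPolynomial

variable {F κ : Type*} [Field F] [Fintype F] [Fintype κ] [DecidableEq κ]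

/-- The vanishing conditions of order `f x` at every point `x`: the coefficients, with all exponents
less than `f x`, of the Taylor expansion at `x`. There are `f x ^ card ι` of them at `x`. -/
noncomputable def vanishingConditions {ι : Type*} [Fintype ι] (f : (ι → F) → ℕ) :
    MvPolynomial ι F →ₗ[F] ((Σ x : ι → F, ι → Fin (f x)) → F) :=
  LinearMap.pi fun b =>
    (lcoeff F (Finsupp.equivFunOnFinite.symm fun i => (b.2 i : ℕ))).comp
      (aeval (fun i => X i + C (b.1 i)) : MvPolynomial ι F →ₐ[F] MvPolynomial ι F).toLinearMap

omit [Fintype F] in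
theorem translate_mem_of_vanishingConditions_eq_zero {ι : Type*} [Fintype ι] {f : (ι → F) → ℕ}
    {P : MvPolynomial ι F} (hP : vanishingConditions f P = 0) (x : ι → F) :
    aeval (fun i => X i + C (x i)) P ∈ idealOfVars ι F ^ f x := by
  rw [mem_pow_idealOfVars_iff']
  intro β hβ
  have hlt : ∀ i, β i < f x := fun i => by
    refine lt_of_le_of_lt ?_ hβ
    rw [Finsupp.degree_eq_sum]
    exact Finset.single_le_sum (f := fun i => β i) (fun _ _ => Nat.zero_le _) (Finset.mem_univ i)
  have := congrFun hP ⟨x, fun i => ⟨β i, hlt i⟩⟩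
  simpa [vanishingConditions] using this

/-- The exponent `k ⌊D / (k² q)⌋` of the factors that vanish at the other directions, in forms of
degree `D`. The degree of these factors stays below `D`, and the exponent is at least `k a_w` for
every direction `w` which contributes forms of degree `D`. -/
abbrev formMultiplicity (κ F : Type*) [Fintype κ] [Fintype F] (D : ℕ) : ℕ :=
  Fintype.card κ * (D / (Fintype.card κ ^ 2 * Fintype.card F))

/-- The indices `(w, j, α)` of the test forms: given weights `a`, every direction `(1, w)`
contributes forms in the degrees `k² q a_w + j`, `j < k² q a_w`, and in each of them one form for
every exponent `α` in the box `[0, a_w)^k`. -/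
abbrev FormIndex (F : Type*) {κ : Type*} [Fintype κ] [Fintype F] (a : (κ → F) → ℕ) : Type _ :=
  Σ w : κ → F, Fin (Fintype.card κ ^ 2 * Fintype.card F * a w) × (κ → Fin (a w))

/-- The degree `k² q a_w + j` of the test form of index `(w, j, α)`. -/
def FormIndex.degree {a : (κ → F) → ℕ} (t : FormIndex F a) : ℕ :=
  Fintype.card κ ^ 2 * Fintype.card F * a t.1 + t.2.1

/-- The test form of a given index: the direction form of the right multiplicity, multiplied by the
power of `X₀` that makes its degree equal to `FormIndex.degree`. -/
noncomputable def FormIndex.form {a : (κ → F) → ℕ} (t : FormIndex F a) :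
    MvPolynomial (Option κ) F :=
  directionForm t.1 (formMultiplicity κ F t.degree)
    (t.degree - (Fintype.card κ * (Fintype.card F - 1) * formMultiplicity κ F t.degree +
      ∑ i, (t.2.2 i : ℕ))) fun i => t.2.2 i

omit [DecidableEq κ] in
theorem FormIndex.weight_le [Nonempty κ] {a : (κ → F) → ℕ} (t : FormIndex F a) :
    a t.1 ≤ t.degree / (Fintype.card κ ^ 2 * Fintype.card F) := by
  rw [Nat.le_div_iff_mul_le (by positivity), FormIndex.degree, mul_comm]
  exact Nat.le_add_right _ _

omit [DecidableEq κ] in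
theorem sum_val_lt_card_mul [Nonempty κ] {a : ℕ} (α : κ → Fin a) :
    ∑ i, (α i : ℕ) < Fintype.card κ * a := by
  refine (Finset.sum_lt_sum_of_nonempty Finset.univ_nonempty fun i _ => (α i).2).trans_le ?_
  simp

theorem multiplicity_mul_add_le {k q a b S D : ℕ} (hk : 0 < k) (hq : 0 < q) (hS : S < k * a)
    (hab : a ≤ b) (hD : k ^ 2 * q * b ≤ D) : k * (q - 1) * (k * b) + S ≤ D := by
  obtain ⟨r, rfl⟩ : ∃ r, q = r + 1 := Nat.exists_eq_succ_of_ne_zero hq.ne'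
  refine le_trans ?_ hD
  have h1 : k * a ≤ k * (k * b) :=
    Nat.mul_le_mul_left _ (hab.trans (Nat.le_mul_of_pos_left b hk))
  calc k * (r + 1 - 1) * (k * b) + S ≤ k * r * (k * b) + k * (k * b) := by
        rw [Nat.add_sub_cancel]
        omega
    _ = k ^ 2 * (r + 1) * b := by ring

omit [DecidableEq κ] in
theorem FormIndex.isHomogeneous_form [Nonempty κ] {a : (κ → F) → ℕ} (t : FormIndex F a) :
    t.form.IsHomogeneous t.degree := by
  have hα := sum_val_lt_card_mul t.2.2
  have hw := t.weight_le
  have hdiv := Nat.mul_div_le t.degree (Fintype.card κ ^ 2 * Fintype.card F)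
  have hle : Fintype.card κ * (Fintype.card F - 1) * formMultiplicity κ F t.degree +
      ∑ i, (t.2.2 i : ℕ) ≤ t.degree :=
    multiplicity_mul_add_le Fintype.card_pos Fintype.card_pos hα hw hdiv
  have := isHomogeneous_directionForm t.1 (formMultiplicity κ F t.degree)
    (t.degree - (Fintype.card κ * (Fintype.card F - 1) * formMultiplicity κ F t.degree +
      ∑ i, (t.2.2 i : ℕ))) fun i => t.2.2 i
  rwa [add_assoc, Nat.sub_add_cancel hle] at this

/-- Nontrivial combinations of the test forms violate the vanishing conditions: on the line
`p w + F (1, w)` the total vanishing order `3 k² q a_w` exceeds the degree, hence the component of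
highest degree would vanish to order `k a_w` at `(1, w)`, and this kills its coefficients. -/
theorem FormIndex.linearIndependent_vanishingConditions [Nonempty κ]
    (f : (Option κ → F) → ℕ) (p : (κ → F) → Option κ → F) (a : (κ → F) → ℕ)
    (ha : ∀ w, ∑ s : F, f (p w + s • slopeDirection w) =
      3 * (Fintype.card κ ^ 2 * Fintype.card F * a w)) :
    LinearIndependent F fun t : FormIndex F a => vanishingConditions f t.form := by
  classical
  rw [Fintype.linearIndependent_iff]
  intro c hc
  by_contra! hne
  obtain ⟨t₀, ht₀, hmax⟩ := Finset.exists_max_image ({t | c t ≠ 0} : Finset (FormIndex F a))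
    FormIndex.degree (by obtain ⟨t, ht⟩ := hne; exact ⟨t, by simpa using ht⟩)
  simp only [Finset.mem_filter, Finset.mem_univ, true_and] at ht₀ hmax
  set D := t₀.degree with hD
  obtain ⟨w₀, j₀, α₀⟩ := t₀
  set m := Fintype.card κ * a w₀ with hm
  set P := ∑ t, c t • t.form with hPdef
  have hP : vanishingConditions f P = 0 := by simpa [hPdef] using hc
  -- Work in the ring of `m`-jets at the direction `(1, w₀)`, in the chart `w₀ + z`.
  set I := idealOfVars κ F ^ m
  let A := MvPolynomial κ F ⧸ I
  let π : MvPolynomial κ F →ₐ[F] A := Ideal.Quotient.mkₐ F I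
  let z : κ → A := fun i => π (X i)
  have hIm : ((idealOfVars κ F).map π) ^ m = ⊥ := by
    rw [← Ideal.map_pow]
    exact Ideal.map_quotient_self I
  have hzmem : ∀ i, z i ∈ (idealOfVars κ F).map π := fun i =>
    Ideal.mem_map_of_mem _ (Ideal.subset_span ⟨i, rfl⟩)
  have hzm : ∀ i, z i ^ m = 0 := fun i => by
    have := Ideal.pow_mem_pow (hzmem i) m
    rwa [hIm, Ideal.mem_bot] at this
  let v : Option κ → A := fun o => algebraMap F A (slopeDirection w₀ o) + transversal z o
  let Φ : MvPolynomial (Option κ) F →ₐ[F] Polynomial A :=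
    aeval fun o => Polynomial.C (algebraMap F A (p w₀ o)) + Polynomial.X * Polynomial.C (v o)
  have hdeg : ∀ t : FormIndex F a, (c t • Φ t.form).natDegree ≤ D ∧
      (c t • Φ t.form).coeff D =
        if t.degree = D then c t • aeval v t.form else 0 := by
    intro t
    have key := natDegree_aeval_line_le_and_coeff_of_isHomogeneous t.isHomogeneous_form
      (fun o => algebraMap F A (p w₀ o)) v
    rcases eq_or_ne (c t) 0 with h0 | h0
    · simp [h0]
    have hle := hmax t h0
    have hdle : (c t • Φ t.form).natDegree ≤ t.degree :=
      (Polynomial.natDegree_smul_le _ _).trans key.1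
    refine ⟨hdle.trans hle, ?_⟩
    split_ifs with htD
    · rw [Polynomial.coeff_smul, ← htD]
      congr 1
      exact key.2
    · exact Polynomial.coeff_eq_zero_of_natDegree_lt (hdle.trans_lt (lt_of_le_of_ne hle htD))
  have hΦP : Φ P = ∑ t, c t • Φ t.form := by simp [hPdef]
  have hzero : Φ P = 0 := by
    refine aeval_line_eq_zero (f := f) (D := D) hIm (y := transversal z) ?_
      (fun s => translate_mem_of_vanishingConditions_eq_zero hP _) ?_ ?_
    · rintro (_ | i)
      · exact Ideal.zero_mem _
      · exact hzmem i
    · change (Φ P).natDegree ≤ D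
      rw [hΦP]
      exact Polynomial.natDegree_sum_le_of_forall_le _ _ fun t _ => (hdeg t).1
    · rw [ha w₀, hD, hm, FormIndex.degree]
      have h1 := j₀.2
      have h2 : Fintype.card F * (Fintype.card κ * a w₀) ≤
          Fintype.card κ ^ 2 * Fintype.card F * a w₀ := by
        have : Fintype.card κ ≤ Fintype.card κ ^ 2 := Nat.le_self_pow two_ne_zero _
        calc _ = Fintype.card κ * (Fintype.card F * a w₀) := by ring
          _ ≤ Fintype.card κ ^ 2 * (Fintype.card F * a w₀) := Nat.mul_le_mul_right _ this
          _ = _ := by ring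
      dsimp only
      omega
  have htop : ∑ t : FormIndex F a, (if t.degree = D then c t • aeval v t.form else 0) = 0 := by
    have := congrArg (fun G => Polynomial.coeff G D) hzero
    simp only [hΦP, Polynomial.finsetSum_coeff, Polynomial.coeff_zero] at this
    exact (Finset.sum_congr rfl fun t _ => (hdeg t).2.symm).trans this
  obtain ⟨U, hU⟩ := exists_unit_aeval_directionForm w₀ (formMultiplicity κ F D)
    fun i => ⟨m, hzm i⟩
  rw [Fintype.sum_sigma, Fintype.sum_eq_single w₀, Fintype.sum_prod_type,
    Fintype.sum_eq_single j₀] at htop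
  · have hsum : (U : A) * ∑ α : κ → Fin (a w₀), c ⟨w₀, j₀, α⟩ • ∏ i, z i ^ (α i : ℕ) = 0 := by
      rw [← htop, Finset.mul_sum]
      refine Finset.sum_congr rfl fun α _ => ?_
      have hα : FormIndex.degree (⟨w₀, j₀, α⟩ : FormIndex F a) = D := rfl
      rw [if_pos hα, FormIndex.form, hα, hU, mul_smul_comm]
    rw [Units.mul_right_eq_zero] at hsum
    have hmem : ∑ α : κ → Fin (a w₀), C (c ⟨w₀, j₀, α⟩) * ∏ i, X i ^ (α i : ℕ) ∈ I := by
      rw [← Ideal.Quotient.eq_zero_iff_mem, ← hsum]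
      change π _ = _
      simp [z, ← MvPolynomial.smul_eq_C_mul]
    have := eq_zero_of_sum_monomial_mem_pow_idealOfVars _ (fun α => sum_val_lt_card_mul α) hmem
    exact ht₀ (congrFun this α₀)
  -- For fixed `w₀`, the degree determines `j`.
  · intro j hj
    refine Finset.sum_eq_zero fun α _ => if_neg fun h => hj ?_
    simp only [hD, FormIndex.degree] at h
    exact Fin.ext (by omega)
  -- The forms attached to other directions vanish to order at least `m` at `(1, w₀)`.
  · intro w hw
    refine Finset.sum_eq_zero fun u _ => ?_
    split_ifs with h
    · rw [FormIndex.form, aeval_directionForm_of_ne hw, smul_zero]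
      intro i
      refine pow_eq_zero_of_le ?_ (hzm i)
      rw [h, hm]
      exact Nat.mul_le_mul_left _ (FormIndex.weight_le ⟨w₀, j₀, α₀⟩)
    · rfl

/-- The number of test forms, `∑_w (k² q a_w) a_w ^ k`, is at most the number of vanishing
conditions. This is the strong Kakeya estimate for integral weights whose sums over the lines
are divisible by `3 k² q`. -/
theorem sum_pow_le_sum_pow_of_line_sum_eq [Nonempty κ]
    (f : (Option κ → F) → ℕ) (p : (κ → F) → Option κ → F) (a : (κ → F) → ℕ)
    (ha : ∀ w, ∑ s : F, f (p w + s • slopeDirection w) =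
      3 * (Fintype.card κ ^ 2 * Fintype.card F * a w)) :
    Fintype.card κ ^ 2 * Fintype.card F * ∑ w, a w ^ (Fintype.card κ + 1) ≤
      ∑ x, f x ^ (Fintype.card κ + 1) := by
  classical
  have := (FormIndex.linearIndependent_vanishingConditions f p a ha).fintype_card_le_finrank
  rw [Module.finrank_fintype_fun_eq_card] at this
  simp only [Fintype.card_sigma, Fintype.card_prod, Fintype.card_fin, Fintype.card_fun,
    Fintype.card_option] at this
  refine le_of_eq_of_le ?_ this
  rw [Finset.mul_sum]
  exact Finset.sum_congr rfl fun w _ => by ring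

end Counting

/-! ### The strong Kakeya maximal estimate in a vector space -/

section Kakeya

variable {F κ : Type*} [Field F] [Fintype F] [Fintype κ] [DecidableEq κ]

/-- The constant of the Kakeya maximal estimate in dimension `k + 1`, for the directions of an
affine chart. -/
def kakeyaConst (k : ℕ) : ℕ := 3 ^ (k + 1) * (k ^ 2) ^ k

theorem sum_line_sum_pow_le_nat [Nonempty κ] (f : (Option κ → F) → ℕ)
    (p : (κ → F) → Option κ → F) :
    ∑ w, (∑ s : F, f (p w + s • slopeDirection w)) ^ (Fintype.card κ + 1) ≤
      kakeyaConst (Fintype.card κ) * Fintype.card F ^ Fintype.card κ *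
        ∑ x, f x ^ (Fintype.card κ + 1) := by
  have hκ : 0 < Fintype.card κ := Fintype.card_pos
  have hF : 0 < Fintype.card F := Fintype.card_pos
  -- Scaling by `3 k² q` makes all the divisions in the choice of the parameters exact.
  have key := sum_pow_le_sum_pow_of_line_sum_eq
    (fun x => 3 * (Fintype.card κ ^ 2 * Fintype.card F) * f x) p
    (fun w => ∑ s : F, f (p w + s • slopeDirection w)) fun w => by
      rw [← Finset.mul_sum]
      ring
  simp only [mul_pow _ (f _), ← Finset.mul_sum] at key
  refine Nat.le_of_mul_le_mul_left (key.trans_eq ?_)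
    (show 0 < Fintype.card κ ^ 2 * Fintype.card F by positivity)
  rw [kakeyaConst]
  ring

open Filter Topology in
theorem sum_line_sum_pow_le [Nonempty κ] (f : (Option κ → F) → ℝ) (hf : ∀ x, 0 ≤ f x)
    (p : (κ → F) → Option κ → F) :
    ∑ w, (∑ s : F, f (p w + s • slopeDirection w)) ^ (Fintype.card κ + 1) ≤
      kakeyaConst (Fintype.card κ) * (Fintype.card F : ℝ) ^ Fintype.card κ *
        ∑ x, f x ^ (Fintype.card κ + 1) := by
  set N := Fintype.card κ + 1 with hN
  set K : ℝ := kakeyaConst (Fintype.card κ) * (Fintype.card F : ℝ) ^ Fintype.card κ with hK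
  have hK0 : 0 ≤ K := by positivity
  -- Round `(L + 1) f` up to integers and let `L` tend to infinity.
  have hL : ∀ L : ℕ, ∑ w, (∑ s : F, f (p w + s • slopeDirection w)) ^ N ≤
      K * ∑ x, (f x + 1 / ((L : ℝ) + 1)) ^ N := by
    intro L
    have hLpos : (0 : ℝ) < (L : ℝ) + 1 := by positivity
    have key := sum_line_sum_pow_le_nat (fun x => ⌈((L : ℝ) + 1) * f x⌉₊) p
    rw [← hN] at key
    have key' : ∑ w, (∑ s : F, (⌈((L : ℝ) + 1) * f (p w + s • slopeDirection w)⌉₊ : ℝ)) ^ N ≤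
        K * ∑ x, (⌈((L : ℝ) + 1) * f x⌉₊ : ℝ) ^ N := by
      rw [hK]
      exact_mod_cast key
    have hlow : ((L : ℝ) + 1) ^ N * ∑ w, (∑ s : F, f (p w + s • slopeDirection w)) ^ N ≤
        ∑ w, (∑ s : F, (⌈((L : ℝ) + 1) * f (p w + s • slopeDirection w)⌉₊ : ℝ)) ^ N := by
      rw [Finset.mul_sum]
      refine Finset.sum_le_sum fun w _ => ?_
      rw [← mul_pow, Finset.mul_sum]
      exact pow_le_pow_left₀ (Finset.sum_nonneg fun s _ => mul_nonneg hLpos.le (hf _))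
        (Finset.sum_le_sum fun s _ => Nat.le_ceil _) N
    have hup : ∑ x, (⌈((L : ℝ) + 1) * f x⌉₊ : ℝ) ^ N ≤
        ((L : ℝ) + 1) ^ N * ∑ x, (f x + 1 / ((L : ℝ) + 1)) ^ N := by
      rw [Finset.mul_sum]
      refine Finset.sum_le_sum fun x _ => ?_
      rw [← mul_pow]
      refine pow_le_pow_left₀ (Nat.cast_nonneg _) ?_ N
      rw [mul_add, mul_one_div_cancel hLpos.ne']
      exact (Nat.ceil_lt_add_one (mul_nonneg hLpos.le (hf x))).le
    refine le_of_mul_le_mul_left (hlow.trans (key'.trans ?_)) (pow_pos hLpos N)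
    calc _ ≤ K * _ := mul_le_mul_of_nonneg_left hup hK0
      _ = _ := by ring
  have hlim : Tendsto (fun L : ℕ => K * ∑ x, (f x + 1 / ((L : ℝ) + 1)) ^ N) atTop
      (𝓝 (K * ∑ x, (f x + 0) ^ N)) :=
    (tendsto_finsetSum _ fun x _ =>
      (tendsto_const_nhds.add tendsto_one_div_add_atTop_nhds_zero_nat).pow N).const_mul K
  simpa using ge_of_tendsto hlim (Eventually.of_forall hL)

variable {V : Type*} [AddCommGroup V] [Module F V]

omit [Fintype F] [Fintype κ] [DecidableEq κ] in
theorem slopeDirection_ne_zero (w : κ → F) : slopeDirection w ≠ 0 := fun h =>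
  one_ne_zero (congrFun h none)

/-- The point of the projective space attached to `(i, w)`: in the coordinates given by `e`, after
exchanging the coordinates `none` and `i`, it is spanned by `(1, w)`. -/
def affineChart (e : V ≃ₗ[F] (Option κ → F)) (a : Option κ × (κ → F)) : ℙ F V :=
  Projectivization.mk F
    ((e.trans (LinearEquiv.funCongrLeft F F (Equiv.swap none a.1))).symm (slopeDirection a.2))
    ((map_ne_zero_iff _ (LinearEquiv.injective _)).2 (slopeDirection_ne_zero a.2))

omit [Fintype F] [Fintype κ] in
theorem affineChart_surjective (e : V ≃ₗ[F] (Option κ → F)) :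
    Function.Surjective (affineChart e) := by
  intro d
  obtain ⟨i, hi⟩ : ∃ i, e d.rep i ≠ 0 :=
    Function.ne_iff.1 ((map_ne_zero_iff e e.injective).2 d.rep_nonzero)
  refine ⟨(i, fun j => (e d.rep i)⁻¹ * e d.rep (Equiv.swap none i (some j))), ?_⟩
  conv_rhs => rw [← d.mk_rep]
  rw [affineChart, Projectivization.mk_eq_mk_iff']
  refine ⟨(e d.rep i)⁻¹, ?_⟩
  rw [LinearEquiv.eq_symm_apply]
  ext (_ | j)
  · simp [slopeDirection, LinearEquiv.funCongrLeft_apply, LinearMap.funLeft_apply, hi]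
  · simp [slopeDirection, LinearEquiv.funCongrLeft_apply, LinearMap.funLeft_apply]

omit [Fintype κ] [DecidableEq κ] in
theorem sum_submodule_mk {M : Type*} [AddCommMonoid M] {v : V} (hv : v ≠ 0)
    [Fintype (Projectivization.mk F v hv).submodule] (g : V → M) :
    ∑ w : (Projectivization.mk F v hv).submodule, g w = ∑ s : F, g (s • v) := by
  symm
  refine Fintype.sum_bijective (fun s : F => (⟨s • v, by
    rw [Projectivization.submodule_mk]
    exact Submodule.mem_span_singleton.2 ⟨s, rfl⟩⟩ : (Projectivization.mk F v hv).submodule))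
    ⟨fun s t h => smul_left_injective F hv (congrArg Subtype.val h), fun w => ?_⟩ _ _
    fun s => rfl
  have hw : (w : V) ∈ Submodule.span F {v} := by
    rw [← Projectivization.submodule_mk v hv]
    exact w.2
  obtain ⟨s, hs⟩ := Submodule.mem_span_singleton.1 hw
  exact ⟨s, Subtype.ext hs⟩

theorem Fintype.sum_le_sum_of_surjective {α β : Type*} [Fintype α] [Fintype β] {φ : α → β}
    (hφ : Function.Surjective φ) {G : β → ℝ} (hG : ∀ b, 0 ≤ G b) :
    ∑ b, G b ≤ ∑ a, G (φ a) := by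
  classical
  obtain ⟨g, hg⟩ := hφ.hasRightInverse
  calc ∑ b, G b = ∑ b, G (φ (g b)) := by simp only [hg _]
    _ = ∑ a ∈ Finset.univ.map ⟨g, hg.injective⟩, G (φ a) := by simp
    _ ≤ _ := Finset.sum_le_univ_sum_of_nonneg fun a => hG _

/-- The Kakeya maximal estimate `ℓ^N → ℓ^N` over a finite field (`N = k + 1`), for an arbitrary
choice of a line in each direction. -/
theorem sum_projectivization_line_sum_pow_le [Nonempty κ] [Fintype V] [Fintype (ℙ F V)]
    [∀ d : ℙ F V, Fintype d.submodule] (e : V ≃ₗ[F] (Option κ → F))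
    (f : V → ℝ) (hf : ∀ x, 0 ≤ f x) (p : ℙ F V → V) :
    ∑ d, (∑ w : d.submodule, f (p d + w)) ^ (Fintype.card κ + 1) ≤
      (Fintype.card κ + 1) * (kakeyaConst (Fintype.card κ) *
        (Fintype.card F : ℝ) ^ Fintype.card κ * ∑ x, f x ^ (Fintype.card κ + 1)) := by
  refine (Fintype.sum_le_sum_of_surjective (affineChart_surjective e) fun d =>
    pow_nonneg (Finset.sum_nonneg fun w _ => hf _) _).trans ?_
  rw [Fintype.sum_prod_type]
  refine (Finset.sum_le_card_nsmul _ _ (kakeyaConst (Fintype.card κ) *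
        (Fintype.card F : ℝ) ^ Fintype.card κ * ∑ x, f x ^ (Fintype.card κ + 1))
        fun i _ => ?_).trans_eq (by simp)
  set e' := e.trans (LinearEquiv.funCongrLeft F F (Equiv.swap none i)) with he'
  have key := sum_line_sum_pow_le (fun x => f (e'.symm x)) (fun x => hf _)
    fun w => e' (p (affineChart e (i, w)))
  simp only [map_add, map_smul, LinearEquiv.symm_apply_apply] at key
  have hsum : ∑ x, f (e'.symm x) ^ (Fintype.card κ + 1) = ∑ v, f v ^ (Fintype.card κ + 1) :=
    Equiv.sum_comp e'.symm.toEquiv fun v => f v ^ (Fintype.card κ + 1)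
  rw [hsum] at key
  refine le_of_eq_of_le (Finset.sum_congr rfl fun w _ => ?_) key
  congr 1
  exact sum_submodule_mk (F := F) _ fun v => f (p (affineChart e (i, w)) + v)

end Kakeya

/-! ### Norms on finite sets -/

section EllNorm

variable {X E : Type} [Fintype X] [NormedAddCommGroup E]

theorem ellNorm_top (g : X → E) : ellNorm ∞ g = ⨆ x, ‖g x‖ :=
  PiLp.norm_eq_ciSup _

theorem ellNorm_ofReal {r : ℝ} (hr : 0 < r) (g : X → E) :
    ellNorm (ENNReal.ofReal r) g = (∑ x, ‖g x‖ ^ r) ^ (1 / r) := by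
  have := PiLp.norm_eq_sum (p := ENNReal.ofReal r) (by rwa [ENNReal.toReal_ofReal hr.le])
    (WithLp.toLp (ENNReal.ofReal r) g)
  rwa [ENNReal.toReal_ofReal hr.le] at this

theorem ellNorm_one (g : X → E) : ellNorm 1 g = ∑ x, ‖g x‖ := by
  simpa using ellNorm_ofReal one_pos g

/-- Exponents in `[1, ∞]` are either `∞` or real numbers `r ≥ 1`. -/
theorem ENNReal.eq_top_or_eq_ofReal {p : ℝ≥0∞} (hp : 1 ≤ p) :
    p = ∞ ∨ ∃ r : ℝ, 1 ≤ r ∧ p = ENNReal.ofReal r := by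
  rcases eq_or_ne p ∞ with h | h
  · exact Or.inl h
  · exact Or.inr ⟨p.toReal, by simpa using ENNReal.toReal_mono h hp,
      (ENNReal.ofReal_toReal h).symm⟩

theorem ENNReal.toReal_inv_ofReal {r : ℝ} (hr : 0 ≤ r) :
    (ENNReal.ofReal r)⁻¹.toReal = 1 / r := by
  rw [ENNReal.toReal_inv, ENNReal.toReal_ofReal hr, one_div]

theorem ellNorm_nonneg {p : ℝ≥0∞} (hp : 1 ≤ p) (g : X → E) : 0 ≤ ellNorm p g := by
  have : Fact (1 ≤ p) := ⟨hp⟩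
  exact norm_nonneg _

theorem norm_apply_le_ellNorm {p : ℝ≥0∞} (hp : 1 ≤ p) (g : X → E) (x : X) :
    ‖g x‖ ≤ ellNorm p g := by
  have : Fact (1 ≤ p) := ⟨hp⟩
  exact PiLp.norm_apply_le (WithLp.toLp p g) x

theorem ellNorm_top_le {g : X → E} {B : ℝ} (hB : 0 ≤ B) (h : ∀ x, ‖g x‖ ≤ B) :
    ellNorm ∞ g ≤ B := by
  rw [ellNorm_top]
  exact Real.iSup_le h hB

theorem ellNorm_ofReal_rpow {r : ℝ} (hr : 0 < r) (g : X → E) :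
    ellNorm (ENNReal.ofReal r) g ^ r = ∑ x, ‖g x‖ ^ r := by
  rw [ellNorm_ofReal hr, ← Real.rpow_mul (Finset.sum_nonneg fun x _ => by positivity),
    one_div_mul_cancel hr.ne', Real.rpow_one]

theorem ellNorm_le_of_sum_rpow_le {r : ℝ} (hr : 0 < r) {g : X → E} {B : ℝ} (hB : 0 ≤ B)
    (h : ∑ x, ‖g x‖ ^ r ≤ B ^ r) : ellNorm (ENNReal.ofReal r) g ≤ B := by
  rw [ellNorm_ofReal hr, one_div]
  exact (Real.rpow_inv_le_iff_of_pos (Finset.sum_nonneg fun x _ => by positivity) hB hr).2 h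

theorem ellNorm_antitone {p q : ℝ≥0∞} (hp : 1 ≤ p) (hpq : p ≤ q) (g : X → E) :
    ellNorm q g ≤ ellNorm p g := by
  have hB := ellNorm_nonneg hp g
  rcases ENNReal.eq_top_or_eq_ofReal (hp.trans hpq) with rfl | ⟨s, hs, rfl⟩
  · exact ellNorm_top_le hB (norm_apply_le_ellNorm hp g)
  rcases ENNReal.eq_top_or_eq_ofReal hp with rfl | ⟨r, hr, rfl⟩
  · simp at hpq
  have hr0 : 0 < r := by linarith
  have hrs : r ≤ s := (ENNReal.ofReal_le_ofReal_iff (by linarith)).1 hpq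
  refine ellNorm_le_of_sum_rpow_le (by linarith) hB ?_
  set B := ellNorm (ENNReal.ofReal r) g with hBdef
  calc ∑ x, ‖g x‖ ^ s = ∑ x, ‖g x‖ ^ (s - r) * ‖g x‖ ^ r :=
        Finset.sum_congr rfl fun x _ => by
          rw [← Real.rpow_add_of_nonneg (norm_nonneg _) (by linarith) hr0.le]
          congr 1
          ring
    _ ≤ ∑ x, B ^ (s - r) * ‖g x‖ ^ r := by
        refine Finset.sum_le_sum fun x _ => mul_le_mul_of_nonneg_right ?_ (by positivity)
        exact Real.rpow_le_rpow (norm_nonneg _) (norm_apply_le_ellNorm hp g x) (by linarith)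
    _ = B ^ s := by
        rw [← Finset.mul_sum, ← ellNorm_ofReal_rpow hr0, ← hBdef,
          ← Real.rpow_add_of_nonneg hB (by linarith) hr0.le]
        congr 1
        ring

theorem ellNorm_le_card_rpow_mul_ellNorm {p q : ℝ≥0∞} (hp : 1 ≤ p) (hpq : p ≤ q) (g : X → E) :
    ellNorm p g ≤ (Fintype.card X : ℝ) ^ (p⁻¹.toReal - q⁻¹.toReal) * ellNorm q g := by
  have hB := ellNorm_nonneg (hp.trans hpq) g
  rcases ENNReal.eq_top_or_eq_ofReal hp with rfl | ⟨r, hr, rfl⟩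
  · rw [top_le_iff] at hpq
    simp [hpq]
  have hr0 : 0 < r := by linarith
  refine ellNorm_le_of_sum_rpow_le hr0 (by positivity) ?_
  rw [Real.mul_rpow (by positivity) hB, ← Real.rpow_mul (by positivity),
    ENNReal.toReal_inv_ofReal hr0.le]
  rcases ENNReal.eq_top_or_eq_ofReal (hp.trans hpq) with rfl | ⟨s, hs, rfl⟩
  · refine (Finset.sum_le_card_nsmul _ _ (ellNorm ∞ g ^ r) fun x _ =>
      Real.rpow_le_rpow (norm_nonneg _) (norm_apply_le_ellNorm le_top g x) hr0.le).trans_eq ?_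
    simp [hr0.ne']
  · have hs0 : 0 < s := by linarith
    have hrs : r ≤ s := (ENNReal.ofReal_le_ofReal_iff hs0.le).1 hpq
    have key := Real.rpow_sum_le_const_mul_sum_rpow_of_nonneg (s := Finset.univ)
      (f := fun x => ‖g x‖ ^ r) (p := s / r) ((one_le_div hr0).2 hrs) fun x _ => by positivity
    have hS : 0 ≤ ∑ x, ‖g x‖ ^ r := Finset.sum_nonneg fun x _ => by positivity
    have hsum : ∑ x, (‖g x‖ ^ r) ^ (s / r) = ∑ x, ‖g x‖ ^ s :=
      Finset.sum_congr rfl fun x _ => by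
        rw [← Real.rpow_mul (norm_nonneg _), mul_div_cancel₀ _ hr0.ne']
    rw [hsum, ← ellNorm_ofReal_rpow hs0] at key
    have := Real.rpow_le_rpow (by positivity) key (show 0 ≤ r / s by positivity)
    rw [← Real.rpow_mul hS, show s / r * (r / s) = 1 by field_simp, Real.rpow_one,
      Real.mul_rpow (by positivity) (by positivity), ← Real.rpow_mul (by positivity),
      ← Real.rpow_mul hB, mul_div_cancel₀ _ hs0.ne'] at this
    refine this.trans_eq ?_
    rw [ENNReal.toReal_inv_ofReal hs0.le, Finset.card_univ]
    congr 2
    field_simp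

end EllNorm

/-! ### Interpolation -/

section Interpolation

variable {X D E : Type} [Fintype X] [Fintype D] [NormedAddCommGroup E]

/-- On the critical line `1 / v = min (1 / u, (1 - 1 / u) / k)`, the strong estimate `ℓ^N → ℓ^N`
(`N = k + 1`) gives the estimate `ℓ^u → ℓ^v` with the loss `q ^ (1 - 1 / u)`. -/
theorem exists_critical_exponent_ellNorm_le {L : D → Finset X} {q k : ℕ} {K : ℝ} (hk : 1 ≤ k)
    (hq : 1 ≤ q) (hL : ∀ d, (L d).card = q) (hK : 1 ≤ K)
    (hE : ∀ G : X → ℝ, (∀ x, 0 ≤ G x) →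
      ∑ d, (∑ x ∈ L d, G x) ^ (k + 1) ≤ K * (q : ℝ) ^ k * ∑ x, G x ^ (k + 1))
    {u : ℝ≥0∞} (hu : 1 ≤ u) (f : X → E) :
    ∃ v : ℝ≥0∞, 1 ≤ v ∧ v⁻¹.toReal = min u⁻¹.toReal ((1 - u⁻¹.toReal) / k) ∧
      ellNorm v (fun d => ∑ x ∈ L d, ‖f x‖) ≤
        K * (q : ℝ) ^ (1 - u⁻¹.toReal) * ellNorm u f := by
  have hT : ∀ d, 0 ≤ ∑ x ∈ L d, ‖f x‖ := fun d => Finset.sum_nonneg fun x _ => norm_nonneg _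
  have hk1 : (1 : ℝ) ≤ k := by exact_mod_cast hk
  have hq0 : (0 : ℝ) < q := by exact_mod_cast hq
  have hB := ellNorm_nonneg hu f
  rcases ENNReal.eq_top_or_eq_ofReal hu with rfl | ⟨r, hr, rfl⟩
  · refine ⟨∞, le_top, ?_, ellNorm_top_le (by positivity) fun d => ?_⟩
    · simp
    · rw [Real.norm_of_nonneg (hT d)]
      calc ∑ x ∈ L d, ‖f x‖ ≤ (L d).card • ellNorm ∞ f :=
            Finset.sum_le_card_nsmul _ _ _ fun x _ => norm_apply_le_ellNorm le_top f x
        _ = 1 * (q * ellNorm ∞ f) := by rw [hL, nsmul_eq_mul, one_mul]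
        _ ≤ K * (q * ellNorm ∞ f) := mul_le_mul_of_nonneg_right hK (by positivity)
        _ = _ := by simp [mul_assoc]
  have hr0 : 0 < r := by linarith
  rw [ENNReal.toReal_inv_ofReal hr0.le]
  set B := ellNorm (ENNReal.ofReal r) f with hBdef
  have hG := hE (fun x => ‖f x‖ ^ (r / (k + 1))) fun x => by positivity
  have hsum : ∑ x, (‖f x‖ ^ (r / (k + 1))) ^ (k + 1) = B ^ r := by
    rw [hBdef, ellNorm_ofReal_rpow hr0]
    refine Finset.sum_congr rfl fun x _ => ?_
    rw [← Real.rpow_natCast, ← Real.rpow_mul (norm_nonneg _)]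
    congr 1
    push_cast
    field_simp
  rw [hsum] at hG
  rcases le_or_gt ((k : ℝ) + 1) r with hkr | hkr
  · -- For `u ≥ N`, apply Hölder on each line and the strong estimate to `|f| ^ (u / N)`.
    refine ⟨ENNReal.ofReal r, by simpa using hr, ?_, ?_⟩
    · rw [ENNReal.toReal_inv_ofReal hr0.le, min_eq_left]
      rw [le_div_iff₀ (by linarith), div_mul_eq_mul_div, div_le_iff₀ hr0]
      have : (1 - 1 / r) * r = r - 1 := by field_simp
      linarith
    refine ellNorm_le_of_sum_rpow_le hr0 (by positivity) ?_
    have hline : ∀ d, ‖∑ x ∈ L d, ‖f x‖‖ ^ r ≤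
        (q : ℝ) ^ (r - (k + 1)) * (∑ x ∈ L d, ‖f x‖ ^ (r / (k + 1))) ^ (k + 1) := by
      intro d
      rw [Real.norm_of_nonneg (hT d)]
      have h1 := Real.rpow_sum_le_const_mul_sum_rpow_of_nonneg (s := L d) (f := fun x => ‖f x‖)
        (p := r / (k + 1)) ((one_le_div (by positivity)).2 hkr) fun x _ => norm_nonneg _
      have h2 := Real.rpow_le_rpow (by have := hT d; positivity) h1
        (show (0 : ℝ) ≤ k + 1 by positivity)
      have hS : 0 ≤ ∑ x ∈ L d, ‖f x‖ ^ (r / (k + 1)) := Finset.sum_nonneg fun x _ => by positivity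
      rw [← Real.rpow_mul (hT d), Real.mul_rpow (by positivity) hS,
        ← Real.rpow_mul (by positivity), hL, div_mul_cancel₀ _ (by positivity)] at h2
      refine h2.trans_eq ?_
      congr 1
      · congr 1
        field_simp
      · exact_mod_cast Real.rpow_natCast _ (k + 1)
    calc ∑ d, ‖∑ x ∈ L d, ‖f x‖‖ ^ r ≤ (q : ℝ) ^ (r - (k + 1)) * (K * (q : ℝ) ^ k * B ^ r) := by
          refine (Finset.sum_le_sum fun d _ => hline d).trans ?_
          rw [← Finset.mul_sum]
          exact mul_le_mul_of_nonneg_left hG (by positivity)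
      _ = K * (q : ℝ) ^ (r - 1) * B ^ r := by
          rw [show r - 1 = (r - (k + 1)) + k by ring, Real.rpow_add hq0, Real.rpow_natCast]
          ring
      _ ≤ K ^ r * (q : ℝ) ^ (r - 1) * B ^ r := by
          have : K ≤ K ^ r := Real.self_le_rpow_of_one_le hK hr
          gcongr
      _ = _ := by
          rw [Real.mul_rpow (by positivity) hB, Real.mul_rpow (by positivity) (by positivity),
            ← Real.rpow_mul hq0.le]
          congr 3
          field_simp
  have hmin : min (1 / r) ((1 - 1 / r) / k) = (1 - 1 / r) / k := by
    rw [min_eq_right]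
    rw [div_le_iff₀ (by linarith), div_mul_eq_mul_div, le_div_iff₀ hr0]
    have : (1 - 1 / r) * r = r - 1 := by field_simp
    linarith
  rw [hmin]
  rcases hr.eq_or_lt with rfl | hr1
  · refine ⟨∞, le_top, by simp, ellNorm_top_le (by positivity) fun d => ?_⟩
    rw [Real.norm_of_nonneg (hT d)]
    calc ∑ x ∈ L d, ‖f x‖ ≤ B := by
          rw [hBdef, ENNReal.ofReal_one, ellNorm_one]
          exact Finset.sum_le_univ_sum_of_nonneg fun x => norm_nonneg _
      _ = 1 * B := (one_mul B).symm
      _ ≤ K * B := mul_le_mul_of_nonneg_right hK hB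
      _ = _ := by simp
  · -- For `1 < u < N`, interpolate with the trivial bound `ℓ^1 → ℓ^∞` by writing
    -- `|f| = |f| ^ (u (1 - θ)) |f| ^ (u θ / N)`.
    set v : ℝ := k * r / (r - 1) with hv
    set θ : ℝ := (k + 1) / v with hθ
    have hr10 : 0 < r - 1 := by linarith
    have hv0 : 0 < v := by positivity
    have hv1 : 1 ≤ v := by
      rw [hv, one_le_div hr10]
      nlinarith
    have hθ0 : 0 < θ := by positivity
    have hθ1 : θ < 1 := by
      rw [hθ, div_lt_one hv0, hv, lt_div_iff₀ hr10]
      nlinarith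
    have hθv : θ * v = k + 1 := div_mul_cancel₀ _ hv0.ne'
    have hkv : k / v = 1 - 1 / r := by
      rw [hv]
      field_simp
    have hexp : r * (1 - θ) + r / (k + 1) * θ = 1 := by
      rw [hθ, hv]
      field_simp
      ring
    refine ⟨ENNReal.ofReal v, by simpa using hv1, ?_, ?_⟩
    · rw [ENNReal.toReal_inv_ofReal hv0.le, ← hkv]
      field_simp
    refine ellNorm_le_of_sum_rpow_le hv0 (by positivity) ?_
    have hline : ∀ d, ‖∑ x ∈ L d, ‖f x‖‖ ^ v ≤
        (B ^ r) ^ ((1 - θ) * v) * (∑ x ∈ L d, ‖f x‖ ^ (r / (k + 1))) ^ (k + 1) := by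
      intro d
      rw [Real.norm_of_nonneg (hT d)]
      have hconj : (1 / (1 - θ)).HolderConjugate (1 / θ) := by
        rw [Real.holderConjugate_iff]
        refine ⟨(one_lt_div (by linarith)).2 (by linarith), by simp⟩
      have hS : 0 ≤ ∑ x ∈ L d, ‖f x‖ ^ (r / (k + 1)) := Finset.sum_nonneg fun x _ => by positivity
      have h1 := Real.inner_le_Lp_mul_Lq_of_nonneg (s := L d)
        (f := fun x => ‖f x‖ ^ (r * (1 - θ))) (g := fun x => ‖f x‖ ^ (r / (k + 1) * θ)) hconj
        (fun x _ => by positivity) (fun x _ => by positivity)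
      have e1 : ∀ x, ‖f x‖ ^ (r * (1 - θ)) * ‖f x‖ ^ (r / (k + 1) * θ) = ‖f x‖ := fun x => by
        rw [← Real.rpow_add_of_nonneg (norm_nonneg _)
          (mul_nonneg hr0.le (by linarith)) (by positivity), hexp, Real.rpow_one]
      have e2 : ∀ x, (‖f x‖ ^ (r * (1 - θ))) ^ (1 / (1 - θ)) = ‖f x‖ ^ r := fun x => by
        rw [← Real.rpow_mul (norm_nonneg _), mul_assoc, mul_one_div_cancel (by linarith), mul_one]
      have e3 : ∀ x, (‖f x‖ ^ (r / (k + 1) * θ)) ^ (1 / θ) = ‖f x‖ ^ (r / (k + 1)) := fun x => by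
        rw [← Real.rpow_mul (norm_nonneg _), mul_assoc, mul_one_div_cancel hθ0.ne', mul_one]
      simp only [e1, e2, e3, one_div_one_div] at h1
      have h2 : ∑ x ∈ L d, ‖f x‖ ^ r ≤ B ^ r := by
        rw [hBdef, ellNorm_ofReal_rpow hr0]
        exact Finset.sum_le_univ_sum_of_nonneg fun x => by positivity
      have h3 : ∑ x ∈ L d, ‖f x‖ ≤
          (B ^ r) ^ (1 - θ) * (∑ x ∈ L d, ‖f x‖ ^ (r / (k + 1))) ^ θ :=
        h1.trans (mul_le_mul_of_nonneg_right (Real.rpow_le_rpow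
          (Finset.sum_nonneg fun x _ => by positivity) h2 (by linarith)) (by positivity))
      refine (Real.rpow_le_rpow (hT d) h3 hv0.le).trans_eq ?_
      rw [Real.mul_rpow (by positivity) (by positivity), ← Real.rpow_mul (by positivity),
        ← Real.rpow_mul hS, hθv]
      congr 1
      exact_mod_cast Real.rpow_natCast _ (k + 1)
    have hBexp : (B ^ r) ^ ((1 - θ) * v) * B ^ r = B ^ v := by
      have h0 : 0 ≤ (1 - θ) * v := mul_nonneg (by linarith) hv0.le
      rw [← Real.rpow_mul hB, ← Real.rpow_add_of_nonneg hB (by positivity) hr0.le]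
      congr 1
      have : r * ((1 - θ) * v) + r = r * (v - k) := by
        rw [sub_mul, hθv]
        ring
      rw [this, hv]
      field_simp
      ring
    calc ∑ d, ‖∑ x ∈ L d, ‖f x‖‖ ^ v
        ≤ (B ^ r) ^ ((1 - θ) * v) * (K * (q : ℝ) ^ k * B ^ r) := by
          refine (Finset.sum_le_sum fun d _ => hline d).trans ?_
          rw [← Finset.mul_sum]
          exact mul_le_mul_of_nonneg_left hG (by positivity)
      _ = K * (q : ℝ) ^ k * B ^ v := by
          rw [← hBexp]
          ring
      _ ≤ K ^ v * (q : ℝ) ^ k * B ^ v := by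
          have : K ≤ K ^ v := Real.self_le_rpow_of_one_le hK hv1
          gcongr
      _ = _ := by
          rw [Real.mul_rpow (by positivity) hB, Real.mul_rpow (by positivity) (by positivity),
            ← Real.rpow_mul hq0.le, ← hkv, div_mul_cancel₀ _ hv0.ne', Real.rpow_natCast]

/-- The estimates off the critical line follow from those on it: norms decrease in the exponent,
and the number of directions is at most `2 q ^ k`. -/
theorem ellNorm_line_sum_le {L : D → Finset X} {q k : ℕ} {K : ℝ} (hk : 1 ≤ k)
    (hq : 1 ≤ q) (hL : ∀ d, (L d).card = q) (hK : 1 ≤ K) (hD : Fintype.card D ≤ 2 * q ^ k)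
    (hE : ∀ G : X → ℝ, (∀ x, 0 ≤ G x) →
      ∑ d, (∑ x ∈ L d, G x) ^ (k + 1) ≤ K * (q : ℝ) ^ k * ∑ x, G x ^ (k + 1))
    {u v : ℝ≥0∞} (hu : 1 ≤ u) (hv : 1 ≤ v) (f : X → E) :
    ellNorm v (fun d => ∑ x ∈ L d, ‖f x‖) ≤
      2 * K * (q : ℝ) ^ (max ((k : ℝ) * v⁻¹.toReal) (max (1 - u⁻¹.toReal)
          (1 + (k : ℝ) * v⁻¹.toReal - (k + 1) * u⁻¹.toReal))) * ellNorm u f := by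
  obtain ⟨w, hw1, hw, hwle⟩ := exists_critical_exponent_ellNorm_le hk hq hL hK hE hu f
  have hB := ellNorm_nonneg hu f
  have hq1 : (1 : ℝ) ≤ q := by exact_mod_cast hq
  have hk1 : (1 : ℝ) ≤ k := by exact_mod_cast hk
  have hK0 : 0 ≤ K := by linarith
  have hle : ∀ {p : ℝ≥0∞}, 1 ≤ p → p⁻¹ ≠ ∞ := fun hp =>
    ENNReal.inv_ne_top.2 (zero_lt_one.trans_le hp).ne'
  rcases le_total w v with hwv | hvw
  · refine (ellNorm_antitone hw1 hwv _).trans (hwle.trans ?_)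
    refine mul_le_mul_of_nonneg_right ?_ hB
    refine mul_le_mul (by linarith) ?_ (by positivity) (by positivity)
    exact Real.rpow_le_rpow_of_exponent_le hq1 ((le_max_left _ _).trans (le_max_right _ _))
  · refine (ellNorm_le_card_rpow_mul_ellNorm hv hvw _).trans ?_
    set a := u⁻¹.toReal
    set b := v⁻¹.toReal with hb
    have hb1 : b ≤ 1 := by
      have := ENNReal.toReal_mono ENNReal.one_ne_top (ENNReal.inv_le_one.2 hv)
      rwa [ENNReal.toReal_one] at this
    have hc0 : 0 ≤ w⁻¹.toReal := ENNReal.toReal_nonneg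
    have hcb : w⁻¹.toReal ≤ b := ENNReal.toReal_mono (hle hv) (ENNReal.inv_le_inv.2 hvw)
    have hcard : (Fintype.card D : ℝ) ^ (b - w⁻¹.toReal) ≤
        2 * (q : ℝ) ^ (k * (b - w⁻¹.toReal)) := by
      have hD' : (Fintype.card D : ℝ) ≤ 2 * (q : ℝ) ^ (k : ℝ) := by
        rw [Real.rpow_natCast]
        exact_mod_cast hD
      refine (Real.rpow_le_rpow (by positivity) hD' (by linarith)).trans ?_
      rw [Real.mul_rpow (by positivity) (by positivity), ← Real.rpow_mul (by positivity)]
      refine mul_le_mul_of_nonneg_right ?_ (by positivity)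
      calc (2 : ℝ) ^ (b - w⁻¹.toReal) ≤ (2 : ℝ) ^ (1 : ℝ) :=
            Real.rpow_le_rpow_of_exponent_le (by norm_num) (by linarith)
        _ = 2 := Real.rpow_one 2
    refine (mul_le_mul hcard hwle (ellNorm_nonneg hw1 _) (by positivity)).trans ?_
    have hexp : k * (b - w⁻¹.toReal) + (1 - a) ≤
        max ((k : ℝ) * b) (max (1 - a) (1 + (k : ℝ) * b - (k + 1) * a)) := by
      rw [hw]
      rcases min_choice a ((1 - a) / k) with h | h <;> rw [h]
      · exact le_of_eq_of_le (by ring) ((le_max_right _ _).trans (le_max_right _ _))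
      · refine le_of_eq_of_le ?_ (le_max_left _ _)
        field_simp
        ring
    calc 2 * (q : ℝ) ^ (k * (b - w⁻¹.toReal)) * (K * (q : ℝ) ^ (1 - a) * ellNorm u f)
        = 2 * K * (q : ℝ) ^ (k * (b - w⁻¹.toReal) + (1 - a)) * ellNorm u f := by
          rw [Real.rpow_add (by linarith)]
          ring
      _ ≤ _ := by
          refine mul_le_mul_of_nonneg_right (mul_le_mul_of_nonneg_left ?_ (by positivity)) hB
          exact Real.rpow_le_rpow_of_exponent_le hq1 hexp

end Interpolation

/-! ### Horizontal lines -/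

namespace Heisenberg

variable {n : ℕ} {F : Type} [Field F] [Fintype F]

open Classical in
/-- The horizontal line as a finite set. -/
noncomputable def lineFinset (p : Heisenberg n F) (d : ℙ F ((Fin n → F) × (Fin n → F))) :
    Finset (Heisenberg n F) :=
  {z | z ∈ horizontalLine p d}

theorem mem_lineFinset {p z : Heisenberg n F} {d : ℙ F ((Fin n → F) × (Fin n → F))} :
    z ∈ lineFinset p d ↔ ∃ w ∈ d.submodule, z = p * horiz w := by
  simp only [lineFinset, Finset.mem_filter, Finset.mem_univ, true_and]
  rfl

omit [Fintype F] in
theorem horiz_injective :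
    Function.Injective (horiz : (Fin n → F) × (Fin n → F) → Heisenberg n F) := fun _ _ h =>
  Prod.ext (congrArg Heisenberg.x h) (congrArg Heisenberg.y h)

theorem sum_lineFinset {M : Type*} [AddCommMonoid M] (p : Heisenberg n F)
    (d : ℙ F ((Fin n → F) × (Fin n → F))) [Fintype d.submodule] (G : Heisenberg n F → M) :
    ∑ z ∈ lineFinset p d, G z =
      ∑ w : d.submodule, G (p * horiz (w : (Fin n → F) × (Fin n → F))) := by
  symm
  refine Finset.sum_bij (fun w _ => p * horiz w.1) (fun w _ => mem_lineFinset.2 ⟨w, w.2, rfl⟩)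
    (fun w _ w' _ h => Subtype.ext (horiz_injective (mul_left_cancel h))) ?_ fun _ _ => rfl
  intro z hz
  obtain ⟨w, hw, rfl⟩ := mem_lineFinset.1 hz
  exact ⟨⟨w, hw⟩, Finset.mem_univ _, rfl⟩

theorem card_lineFinset (p : Heisenberg n F) (d : ℙ F ((Fin n → F) × (Fin n → F))) :
    (lineFinset p d).card = Fintype.card F := by
  induction d with | h v hv
  have : Fintype (Projectivization.mk F v hv).submodule := Fintype.ofFinite _
  rw [Finset.card_eq_sum_ones, sum_lineFinset, sum_submodule_mk hv fun _ => 1]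
  simp

theorem sum_lineFinset_le_kakeyaMaximal (f : Heisenberg n F → ℂ) (p : Heisenberg n F)
    (d : ℙ F ((Fin n → F) × (Fin n → F))) :
    ∑ z ∈ lineFinset p d, ‖f z‖ ≤ kakeyaMaximal f d :=
  le_ciSup (f := fun p => ∑ z ∈ lineFinset p d, ‖f z‖) (Set.finite_range _).bddAbove p

theorem exists_kakeyaMaximal_eq (f : Heisenberg n F → ℂ) :
    ∃ P : ℙ F ((Fin n → F) × (Fin n → F)) → Heisenberg n F,
      kakeyaMaximal f = fun d => ∑ z ∈ lineFinset (P d) d, ‖f z‖ := by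
  have h : ∀ d, ∃ p, ∑ z ∈ lineFinset p d, ‖f z‖ = kakeyaMaximal f d := fun d =>
    exists_eq_ciSup_of_finite (f := fun p => ∑ z ∈ lineFinset p d, ‖f z‖)
  choose P hP using h
  exact ⟨P, funext fun d => (hP d).symm⟩

/-- Horizontal lines project to lines of `F^{2n}`. Replacing a function on the Heisenberg group by
its maximum over the centre reduces the horizontal estimate to the estimate in `F^{2n}`. -/
theorem sum_lineFinset_sum_pow_le (hn : 1 ≤ n) (G : Heisenberg n F → ℝ) (hG : ∀ z, 0 ≤ G z)
    (P : ℙ F ((Fin n → F) × (Fin n → F)) → Heisenberg n F) :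
    ∑ d, (∑ z ∈ lineFinset (P d) d, G z) ^ (2 * n - 1 + 1) ≤
      ((2 * n - 1 + 1 : ℕ) * kakeyaConst (2 * n - 1) : ℝ) *
        (Fintype.card F : ℝ) ^ (2 * n - 1) * ∑ z, G z ^ (2 * n - 1 + 1) := by
  have : Nonempty (Fin (2 * n - 1)) := ⟨⟨0, by omega⟩⟩
  have : ∀ d : ℙ F ((Fin n → F) × (Fin n → F)), Fintype d.submodule := fun d =>
    Fintype.ofFinite _
  have e : ((Fin n → F) × (Fin n → F)) ≃ₗ[F] (Option (Fin (2 * n - 1)) → F) :=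
    LinearEquiv.ofFinrankEq _ _ (by simp; omega)
  have hmax : ∀ v : (Fin n → F) × (Fin n → F), ∃ t : F, ∀ s : F,
      G ⟨v.1, v.2, s⟩ ≤ G ⟨v.1, v.2, t⟩ := fun v => Finite.exists_max _
  choose τ hτ using hmax
  have key := sum_projectivization_line_sum_pow_le e (fun v => G ⟨v.1, v.2, τ v⟩)
    (fun v => hG _) fun d => ((P d).x, (P d).y)
  simp only [Fintype.card_fin] at key
  have hfib : ∑ v : (Fin n → F) × (Fin n → F), G ⟨v.1, v.2, τ v⟩ ^ (2 * n - 1 + 1) ≤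
      ∑ z, G z ^ (2 * n - 1 + 1) := by
    have hinj : Function.Injective
        fun v : (Fin n → F) × (Fin n → F) => (⟨v.1, v.2, τ v⟩ : Heisenberg n F) := fun v w h =>
      Prod.ext (congrArg Heisenberg.x h) (congrArg Heisenberg.y h)
    calc _ = ∑ z ∈ Finset.univ.map ⟨_, hinj⟩, G z ^ (2 * n - 1 + 1) := by simp
      _ ≤ _ := Finset.sum_le_univ_sum_of_nonneg fun z => pow_nonneg (hG z) _
  calc ∑ d, (∑ z ∈ lineFinset (P d) d, G z) ^ (2 * n - 1 + 1)
      ≤ _ := Finset.sum_le_sum fun d _ => by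
        refine pow_le_pow_left₀ (Finset.sum_nonneg fun z _ => hG z) ?_ _
        rw [sum_lineFinset]
        exact Finset.sum_le_sum fun w _ => hτ (((P d).x, (P d).y) + (w : _ × _)) _
    _ ≤ _ := key
    _ ≤ _ := by
        push_cast
        rw [← mul_assoc, ← mul_assoc]
        exact mul_le_mul_of_nonneg_left hfib (by positivity)

/-- With `q` elements in the field, there are between `q ^ (2n - 1)` and `2 q ^ (2n - 1)`
directions. -/
theorem card_projectivization (hn : 1 ≤ n) :
    Fintype.card F ^ (2 * n - 1) ≤ Fintype.card (ℙ F ((Fin n → F) × (Fin n → F))) ∧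
      Fintype.card (ℙ F ((Fin n → F) × (Fin n → F))) ≤ 2 * Fintype.card F ^ (2 * n - 1) := by
  have h := Projectivization.card' F ((Fin n → F) × (Fin n → F))
  have hq : 1 < Fintype.card F := Fintype.one_lt_card
  simp only [Nat.card_eq_fintype_card, Fintype.card_prod, Fintype.card_fun, Fintype.card_fin,
    ← pow_add] at h
  rw [show n + n = 2 * n - 1 + 1 by omega, pow_succ] at h
  obtain ⟨r, hr⟩ : ∃ r, Fintype.card F = r + 2 := ⟨Fintype.card F - 2, by omega⟩
  have hQ : 0 < Fintype.card F ^ (2 * n - 1) := by positivity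
  generalize Fintype.card F ^ (2 * n - 1) = Q at *
  generalize Fintype.card (ℙ F ((Fin n → F) × (Fin n → F))) = c at *
  rw [hr, show r + 2 - 1 = r + 1 by omega] at h
  constructor <;> by_contra! hlt
  · nlinarith
  · nlinarith

/-- The upper bound, with a constant that depends only on `n`. -/
theorem ellNorm_kakeyaMaximal_le (hn : 1 ≤ n) {u v : ℝ≥0∞} (hu : 1 ≤ u) (hv : 1 ≤ v)
    (f : Heisenberg n F → ℂ) :
    ellNorm v (kakeyaMaximal f) ≤
      2 * ((2 * n - 1 + 1 : ℕ) * kakeyaConst (2 * n - 1)) *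
        (Fintype.card F : ℝ) ^ (max ((2 * (n : ℝ) - 1) * v⁻¹.toReal) (max (1 - u⁻¹.toReal)
          (1 + (2 * (n : ℝ) - 1) * v⁻¹.toReal - 2 * (n : ℝ) * u⁻¹.toReal))) * ellNorm u f := by
  obtain ⟨P, hP⟩ := exists_kakeyaMaximal_eq f
  have hk : ((2 * n - 1 : ℕ) : ℝ) = 2 * n - 1 := by
    rw [Nat.cast_sub (by omega)]
    push_cast
    ring
  have hK : (1 : ℝ) ≤ (2 * n - 1 + 1 : ℕ) * kakeyaConst (2 * n - 1) := by
    have : 0 < 2 * n - 1 := by omega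
    have : 0 < (2 * n - 1 + 1) * kakeyaConst (2 * n - 1) := by
      unfold kakeyaConst
      positivity
    exact_mod_cast this
  have key := ellNorm_line_sum_le (L := fun d => lineFinset (P d) d) (k := 2 * n - 1) (by omega)
    Fintype.card_pos (fun d => card_lineFinset (P d) d) hK (card_projectivization hn).2
    (fun G hG => sum_lineFinset_sum_pow_le hn G hG P) hu hv f
  rw [hk, sub_add_cancel] at key
  rw [hP]
  exact key

end Heisenberg

/-! ### Sharpness -/

section Sharpness

open Filter Topology

/-- Comparison of powers of `q` along the prime fields. -/
theorem le_of_forall_prime_rpow_le {a A C : ℝ}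
    (h : ∀ p : ℕ, p.Prime → (p : ℝ) ^ a ≤ C * (p : ℝ) ^ A) : a ≤ A := by
  by_contra! hlt
  have htop : Tendsto (fun p : ℕ => (p : ℝ) ^ (a - A)) atTop atTop :=
    (tendsto_rpow_atTop (sub_pos.2 hlt)).comp tendsto_natCast_atTop_atTop
  obtain ⟨p, hpC, hp⟩ :=
    ((htop.eventually_gt_atTop C).and_frequently
      (Nat.frequently_atTop_iff_infinite.2 Nat.infinite_setOfPred_prime)).exists
  have hp0 : (0 : ℝ) < p := by exact_mod_cast hp.pos
  rw [Real.rpow_sub hp0, lt_div_iff₀ (by positivity)] at hpC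
  exact absurd (h p hp) (not_le.2 hpC)

variable {X : Type} [Fintype X]

theorem ellNorm_indicator_le {u : ℝ≥0∞} (hu : 1 ≤ u) (S : Finset X) (hS : S.Nonempty) :
    ellNorm u ((S : Set X).indicator (1 : X → ℂ)) ≤ (S.card : ℝ) ^ u⁻¹.toReal := by
  classical
  rcases ENNReal.eq_top_or_eq_ofReal hu with rfl | ⟨r, hr, rfl⟩
  · refine ellNorm_top_le (by positivity) fun x => ?_
    simp only [Set.indicator_apply]
    split_ifs <;> simp
  · have hr0 : 0 < r := by linarith
    refine ellNorm_le_of_sum_rpow_le hr0 (by positivity) ?_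
    rw [ENNReal.toReal_inv_ofReal hr0.le, ← Real.rpow_mul (by positivity),
      one_div_mul_cancel hr0.ne', Real.rpow_one]
    refine le_of_eq ?_
    have : ∀ x, ‖(S : Set X).indicator (1 : X → ℂ) x‖ ^ r = if x ∈ S then 1 else 0 := fun x => by
      simp only [Set.indicator_apply, Finset.mem_coe]
      split_ifs <;> simp [hr0.ne']
    simp [this]

theorem mul_card_rpow_le_ellNorm [Nonempty X] {v : ℝ≥0∞} (hv : 1 ≤ v) {g : X → ℝ} {c : ℝ}
    (hc : 0 ≤ c) (h : ∀ x, c ≤ g x) : c * (Fintype.card X : ℝ) ^ v⁻¹.toReal ≤ ellNorm v g := by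
  have h' : ∀ x, c ≤ ‖g x‖ := fun x => (h x).trans (le_abs_self _)
  rcases ENNReal.eq_top_or_eq_ofReal hv with rfl | ⟨r, hr, rfl⟩
  · obtain ⟨x⟩ := ‹Nonempty X›
    simpa using (h' x).trans (norm_apply_le_ellNorm le_top g x)
  · have hr0 : 0 < r := by linarith
    rw [ENNReal.toReal_inv_ofReal hr0.le, ← Real.rpow_le_rpow_iff (by positivity)
      (ellNorm_nonneg hv g) hr0, ellNorm_ofReal_rpow hr0, Real.mul_rpow hc (by positivity),
      ← Real.rpow_mul (by positivity), one_div_mul_cancel hr0.ne', Real.rpow_one]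
    calc c ^ r * (Fintype.card X : ℝ) = ∑ _x : X, c ^ r := by simp [mul_comm]
      _ ≤ _ := Finset.sum_le_sum fun x _ => Real.rpow_le_rpow hc (h' x) hr0.le

namespace Heisenberg

variable {n : ℕ} {F : Type} [Field F] [Fintype F]

theorem card_le_kakeyaMaximal_indicator {S T : Finset (Heisenberg n F)}
    {d : ℙ F ((Fin n → F) × (Fin n → F))} (p : Heisenberg n F) (hTS : T ⊆ S)
    (hT : T ⊆ lineFinset p d) :
    (T.card : ℝ) ≤ kakeyaMaximal ((S : Set (Heisenberg n F)).indicator 1) d := by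
  refine le_trans ?_ (sum_lineFinset_le_kakeyaMaximal _ p d)
  refine le_trans (le_of_eq ?_)
    (Finset.sum_le_sum_of_subset_of_nonneg hT fun _ _ _ => norm_nonneg _)
  rw [Finset.sum_congr rfl fun z hz => by
    rw [Set.indicator_of_mem (Finset.mem_coe.2 (hTS hz)), Pi.one_apply, norm_one]]
  simp

/-- The section `t = 0`. It contains the horizontal lines through the origin. -/
def horizontalPlane (n : ℕ) (F : Type) [Field F] [Fintype F] : Finset (Heisenberg n F) :=
  Finset.univ.map ⟨horiz, horiz_injective⟩

theorem card_horizontalPlane :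
    (horizontalPlane n F).card = Fintype.card F ^ (2 * n) := by
  simp [horizontalPlane, two_mul, pow_add]

theorem lineFinset_one_subset (d : ℙ F ((Fin n → F) × (Fin n → F))) :
    lineFinset 1 d ⊆ horizontalPlane n F := by
  intro z hz
  obtain ⟨w, -, rfl⟩ := mem_lineFinset.1 hz
  simp [horizontalPlane]

theorem one_mem_lineFinset (d : ℙ F ((Fin n → F) × (Fin n → F))) :
    (1 : Heisenberg n F) ∈ lineFinset 1 d :=
  mem_lineFinset.2 ⟨0, d.submodule.zero_mem, by rw [one_mul]; rfl⟩

/-- The three test functions: a horizontal line, a point, and the plane `t = 0`. -/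
theorem necessary_bounds (hn : 1 ≤ n) {u v : ℝ≥0∞} (hu : 1 ≤ u) (hv : 1 ≤ v) {B : ℝ} (hB : 0 ≤ B)
    (h : ∀ f : Heisenberg n F → ℂ, ellNorm v (kakeyaMaximal f) ≤ B * ellNorm u f) :
    (Fintype.card F : ℝ) ^ (1 - u⁻¹.toReal) ≤ B ∧
      (Fintype.card F : ℝ) ^ ((2 * (n : ℝ) - 1) * v⁻¹.toReal) ≤ B ∧
      (Fintype.card F : ℝ) ^
        (1 + (2 * (n : ℝ) - 1) * v⁻¹.toReal - 2 * (n : ℝ) * u⁻¹.toReal) ≤ B := by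
  have hq : (0 : ℝ) < Fintype.card F := by exact_mod_cast Fintype.card_pos
  have hk : ((2 * n - 1 : ℕ) : ℝ) = 2 * n - 1 := by
    rw [Nat.cast_sub (by omega)]
    push_cast
    ring
  have : Nonempty (Fin n) := ⟨⟨0, hn⟩⟩
  have hne : Nonempty (ℙ F ((Fin n → F) × (Fin n → F))) := inferInstance
  have hP : (Fintype.card F : ℝ) ^ ((2 * (n : ℝ) - 1) * v⁻¹.toReal) ≤
      (Fintype.card (ℙ F ((Fin n → F) × (Fin n → F))) : ℝ) ^ v⁻¹.toReal := by
    rw [Real.rpow_mul hq.le, ← hk, Real.rpow_natCast]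
    refine Real.rpow_le_rpow (by positivity) ?_ ENNReal.toReal_nonneg
    exact_mod_cast (card_projectivization hn).1
  refine ⟨?_, ?_, ?_⟩
  · obtain ⟨d⟩ := hne
    have hcard := card_lineFinset (1 : Heisenberg n F) d
    have h1 := ellNorm_indicator_le hu (lineFinset 1 d) ⟨1, one_mem_lineFinset d⟩
    have h2 := (card_le_kakeyaMaximal_indicator (S := lineFinset 1 d) 1 subset_rfl
      subset_rfl).trans ((le_abs_self _).trans (norm_apply_le_ellNorm hv
        (kakeyaMaximal ((lineFinset 1 d : Set (Heisenberg n F)).indicator 1)) d))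
    rw [hcard] at h1 h2
    rw [Real.rpow_sub hq, Real.rpow_one, div_le_iff₀ (by positivity)]
    exact h2.trans ((h _).trans (mul_le_mul_of_nonneg_left h1 hB))
  · have h1 := ellNorm_indicator_le hu ({1} : Finset (Heisenberg n F)) ⟨1, by simp⟩
    have h2 := mul_card_rpow_le_ellNorm hv zero_le_one fun d => by
      simpa using card_le_kakeyaMaximal_indicator (S := {(1 : Heisenberg n F)}) (d := d) 1
        subset_rfl (by simpa using one_mem_lineFinset d)
    rw [one_mul] at h2
    refine hP.trans (h2.trans ((h _).trans ?_))
    simpa using mul_le_mul_of_nonneg_left h1 hB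
  · have h1 := ellNorm_indicator_le hu (horizontalPlane n F)
      (Finset.card_pos.1 (by rw [card_horizontalPlane]; exact pow_pos Fintype.card_pos _))
    have hmax : ∀ d, (Fintype.card F : ℝ) ≤
        kakeyaMaximal ((horizontalPlane n F : Set (Heisenberg n F)).indicator 1) d := fun d => by
      have := card_le_kakeyaMaximal_indicator 1 (lineFinset_one_subset d) subset_rfl
      rwa [card_lineFinset] at this
    have h2 := mul_card_rpow_le_ellNorm hv hq.le hmax
    rw [card_horizontalPlane, Nat.cast_pow, ← Real.rpow_natCast, Nat.cast_mul, Nat.cast_two] at h1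
    rw [Real.rpow_sub hq, Real.rpow_add hq, Real.rpow_one, div_le_iff₀ (by positivity),
      Real.rpow_mul hq.le (2 * (n : ℝ))]
    exact (mul_le_mul_of_nonneg_left hP hq.le).trans
      (h2.trans ((h _).trans (mul_le_mul_of_nonneg_left h1 hB)))

end Heisenberg

end Sharpness

theorem theorem1p2 (n : ℕ) (hn : 1 ≤ n) (u v : ℝ≥0∞) (hu : 1 ≤ u) (hv : 1 ≤ v) :
    IsLeast (admissibleExponents n u v)
      (max ((2 * (n : ℝ) - 1) * v⁻¹.toReal)
        (max (1 - u⁻¹.toReal)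
          (1 + (2 * (n : ℝ) - 1) * v⁻¹.toReal - 2 * (n : ℝ) * u⁻¹.toReal))) := by
  have hn1 : (1 : ℝ) ≤ n := by exact_mod_cast hn
  refine ⟨⟨le_max_of_le_left (mul_nonneg (by linarith) ENNReal.toReal_nonneg),
    2 * ((2 * n - 1 + 1 : ℕ) * kakeyaConst (2 * n - 1)), ?_, fun F _ _ f =>
      Heisenberg.ellNorm_kakeyaMaximal_le hn hu hv f⟩, ?_⟩
  · have : 0 < 2 * n - 1 := by omega
    unfold kakeyaConst
    positivity
  · rintro A ⟨-, C, hC, h⟩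
    have key := fun (p : ℕ) (_ : Fact p.Prime) =>
      Heisenberg.necessary_bounds (F := ZMod p) hn hu hv (B := C * (Fintype.card (ZMod p) : ℝ) ^ A)
        (by positivity) (h (ZMod p))
    simp only [ZMod.card] at key
    exact max_le (le_of_forall_prime_rpow_le fun p hp => (key p ⟨hp⟩).2.1)
      (max_le (le_of_forall_prime_rpow_le fun p hp => (key p ⟨hp⟩).1)
        (le_of_forall_prime_rpow_le fun p hp => (key p ⟨hp⟩).2.2))
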